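/- Notation and definitions. All spaces are real and $\mathbb{N}=\{1,2,\dots\}$. Trees are sets of finite sequences closed under initial segments; a tree on $\mathbb N$ is ill-founded if it has an infinite branch, and $[T]$ denotes the set of all infinite branches of $T$. If $\mathcal{T}$ is a tree on $\{0,1\}\times\mathbb{N}$ (its elements being regarded as pairs of finite sequences of the same length) and $\sigma\in 2^{\mathbb{N}}$, the section $\mathcal{T}(\sigma)=\{\nu\in\mathbb{N}^{<\mathbb{N}} : (\sigma|_{|\nu|},\nu)\in\mathcal{T}\}$ is a tree on $\mathbb N$. For a system $\mathcal{M}$ of subsets of $\mathbb{N}$, a family $\{E_1,\dots,E_n\}$ of non-empty finite subsets of $\mathbb{N}$ is $\mathcal{M}$-admissible if some element of $\mathcal{M}$ contains numbers $m_1,\dots,m_n$ with $m_1\le E_1<m_2\le E_2<\dots<m_n\le E_n$. Let $\Theta_{\mathcal{M}}$ be the smallest absolutely convex subset of $c_{00}(\mathbb{N})$ that contains all canonical basic vectors $e_i$, $i\in\mathbb{N}$, and satisfies $\frac12\sum_{k=1}^n E_kx_k\in\Theta_{\mathcal{M}}$ whenever $\{E_1,\dots,E_n\}$ is $\mathcal{M}$-admissible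 and $x_1,\dots,x_n\in\Theta_{\mathcal{M}}$, where $Ex=\mathbf{1}_E\cdot x$. Let $\|\cdot\|_{\mathcal{M}}$ be the Minkowski gauge of $\Theta_{\mathcal{M}}$. For a finite or infinite sequence $\nu=(n_1,n_2,\dots)$ in $\mathbb{N}$ put $\tilde\nu=\{n_1,\,n_1+n_2,\,n_1+n_2+n_3,\dots\}$, and for a tree $T$ on $\mathbb{N}$ put $\mathcal{M}_T=\{\tilde\nu : \nu\in T\cup[T] \text{ or } |\nu|\le 3\}$. For a tree $\mathcal{T}$ on $\{0,1\}\times\mathbb{N}$, let $E_{\mathcal{T}}$ be the completion of $c_{00}(2^{<\mathbb{N}}\setminus\{\emptyset\})$ in the norm $$\|x\|_{\mathcal{T}}=\sup_{\sigma\in 2^{\mathbb{N}}}\Big\|\sum_{\ell=1}^\infty x(\sigma|_\ell)e_\ell\Big\|_{\mathcal{M}_{\mathcal{T}(\sigma)}},$$ and write $\|\cdot\|_{\mathcal{T}}$ also for the dual norm on $E_{\mathcal{T}}^*$. Lemma. Let $\mathcal{T}$ be a tree on $\{0,1\}\times\mathbb{N}$ such that $\mathcal{T}(\sigma)$ is ill-founded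 for every $\sigma\in 2^{\mathbb{N}}$. If $x_1^*,x_2^*,\dots$ is a normalized sequence in $E_{\mathcal{T}}^*$ (that is, $\|x_k^*\|_{\mathcal{T}}=1$ for all $k$) which converges to $0$ in the $w^*$-topology, then it has a subsequence $y_1^*,y_2^*,\dots$ such that $$\Big\|\sum_{k=1}^n\lambda_ky_k^*\Big\|_{\mathcal{T}}\ge\frac15\sum_{k=1}^n|\lambda_k|$$ for all $n\in\mathbb{N}$ and $\lambda_1,\dots,\lambda_n\in\mathbb{R}$. -/

import Mathlib

open Filter Topology
open scoped Pointwise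

noncomputable section

namespace TreeSpace

/-! ### Sequences, trees and branches -/

/-- The initial segment of length `ℓ` of an infinite sequence. -/
def initSeg {A : Type*} (σ : ℕ → A) (ℓ : ℕ) : List A := List.ofFn fun i : Fin ℓ => σ i

theorem length_initSeg {A : Type*} (σ : ℕ → A) (ℓ : ℕ) : (initSeg σ ℓ).length = ℓ := by
  simp [initSeg]

theorem initSeg_succ {A : Type*} (σ : ℕ → A) (ℓ : ℕ) :
    initSeg σ (ℓ + 1) = initSeg σ ℓ ++ [σ ℓ] := by
  rw [initSeg, List.ofFn_succ', List.concat_eq_append]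
  rfl

/-- The set `[T]` of all infinite branches of a tree `T`. -/
def branches {A : Type*} (T : Descriptive.tree A) : Set (ℕ → A) :=
  {ν | ∀ ℓ, initSeg ν ℓ ∈ T}

/-- A tree is ill-founded if it has an infinite branch. -/
def IllFounded {A : Type*} (T : Descriptive.tree A) : Prop := (branches T).Nonempty

/-- The section `T(σ)` of a tree `T` on `Θ × Λ`: all `ν` with `(σ|_{|ν|}, ν) ∈ T`, where a pair of
sequences of the same length is identified with a sequence of pairs. -/
def sect {Θ Λ : Type*} (T : Descriptive.tree (Θ × Λ)) (σ : ℕ → Θ) : Descriptive.tree Λ :=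
  ⟨{ν | List.zip (initSeg σ ν.length) ν ∈ T}, by
    intro ν a h
    have h' : List.zip (initSeg σ (ν ++ [a]).length) (ν ++ [a]) ∈ T := h
    rw [List.length_append, List.length_singleton, initSeg_succ,
      List.zip_append (length_initSeg _ _)] at h'
    exact Descriptive.Tree.mem_of_append h'⟩

/-! ### The norm of the Tsirelson type space given by a system `M` of subsets of `{1, 2, …}`

The set `{1, 2, …}` is `ℕ+`, and `c₀₀` is `ℕ+ →₀ ℝ`. -/

/-- The family `E 0, …, E (n-1)` of (nonempty) successive finite sets is `M`-admissible: some element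
of `M` contains `m 0, …, m (n-1)` with `m 0 ≤ E 0 < m 1 ≤ E 1 < … < m (n-1) ≤ E (n-1)`. -/
def Admissible (M : Set (Set ℕ+)) {n : ℕ} (E : Fin n → Finset ℕ+) : Prop :=
  (∀ k, (E k).Nonempty) ∧
    ∃ A ∈ M, ∃ m : Fin n → ℕ+, (∀ k, m k ∈ A) ∧
      (∀ k, ∀ i ∈ E k, m k ≤ i) ∧ (∀ k l, k < l → ∀ i ∈ E k, i < m l)

/-- The restriction `Ex` of `x ∈ c₀₀` to `E`. -/
def restrict (E : Finset ℕ+) (x : ℕ+ →₀ ℝ) : ℕ+ →₀ ℝ := x.filter (· ∈ E)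

/-- The properties in the definition of `Θ_M`. -/
structure IsThetaLike (M : Set (Set ℕ+)) (S : Set (ℕ+ →₀ ℝ)) : Prop where
  absConvex : AbsConvex ℝ S
  single_mem : ∀ i : ℕ+, Finsupp.single i 1 ∈ S
  half_sum_mem : ∀ (n : ℕ) (E : Fin n → Finset ℕ+) (x : Fin n → ℕ+ →₀ ℝ),
    Admissible M E → (∀ k, x k ∈ S) → (1 / 2 : ℝ) • ∑ k, restrict (E k) (x k) ∈ S

/-- `Θ_M`: the smallest set which has these properties. -/
def theta (M : Set (Set ℕ+)) : Set (ℕ+ →₀ ℝ) := ⋂₀ {S | IsThetaLike M S}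

/-- The norm `‖·‖_M` on `c₀₀`: the Minkowski gauge of `Θ_M`. -/
def tsirelsonNorm (M : Set (Set ℕ+)) (x : ℕ+ →₀ ℝ) : ℝ := gauge (theta M) x

theorem isThetaLike_theta (M : Set (Set ℕ+)) : IsThetaLike M (theta M) where
  absConvex := AbsConvex.sInter fun _ hS => hS.absConvex
  single_mem i := fun _ hS => hS.single_mem i
  half_sum_mem n E x hE hx := fun S hS => hS.half_sum_mem n E x hE fun k => hx k S hS

theorem theta_small (M : Set (Set ℕ+)) (x : ℕ+ →₀ ℝ) :
    ∃ r : ℝ, 0 < r ∧ ∀ c : ℝ, |c| ≤ r → c • x ∈ theta M := by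
  have hT := isThetaLike_theta M
  have h0 : (0 : ℕ+ →₀ ℝ) ∈ theta M := by
    have := hT.absConvex.1 0 (by simp) (Set.smul_mem_smul_set (hT.single_mem 1))
    simpa using this
  induction x using Finsupp.induction_linear with
  | zero => exact ⟨1, one_pos, fun c _ => by simpa using h0⟩
  | add x y hx hy =>
    obtain ⟨r, hr, hx⟩ := hx
    obtain ⟨s, hs, hy⟩ := hy
    refine ⟨min r s / 2, by positivity, fun c hc => ?_⟩
    have h2 : |2 * c| ≤ min r s := by rw [abs_mul, abs_two]; linarith
    have := convex_iff_forall_pos.1 hT.absConvex.2 (hx (2 * c) (h2.trans (min_le_left _ _)))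
      (hy (2 * c) (h2.trans (min_le_right _ _))) (show (0 : ℝ) < 1 / 2 by norm_num)
      (show (0 : ℝ) < 1 / 2 by norm_num) (by norm_num)
    rw [smul_smul, smul_smul, ← smul_add] at this
    convert this using 2
    ring
  | single i a =>
    refine ⟨1 / (|a| + 1), by positivity, fun c hc => ?_⟩
    have h1 : ‖c * a‖ ≤ 1 := by
      rw [Real.norm_eq_abs, abs_mul]
      have : |c| * (|a| + 1) ≤ 1 := by
        rwa [le_div_iff₀ (by positivity)] at hc
      nlinarith [abs_nonneg c]
    have := hT.absConvex.1 (c * a) h1 (Set.smul_mem_smul_set (hT.single_mem i))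
    simpa using this

theorem absorbent_theta (M : Set (Set ℕ+)) : Absorbent ℝ (theta M) := by
  rw [absorbent_iff_eventually_nhdsNE_zero]
  intro x
  obtain ⟨r, hr, h⟩ := theta_small M x
  refine mem_nhdsWithin_of_mem_nhds ?_
  filter_upwards [Metric.closedBall_mem_nhds (0 : ℝ) hr] with c hc
  exact h c (by simpa using hc)

theorem abs_le_one_of_mem_theta (M : Set (Set ℕ+)) {x : ℕ+ →₀ ℝ} (hx : x ∈ theta M) (i : ℕ+) :
    |x i| ≤ 1 := by
  have key : IsThetaLike M {x : ℕ+ →₀ ℝ | ∀ i, |x i| ≤ 1} := by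
    refine ⟨⟨?_, ?_⟩, ?_, ?_⟩
    · rintro a ha _ ⟨y, hy, rfl⟩ i
      have : |a| ≤ 1 := by simpa using ha
      simpa [abs_mul] using mul_le_one₀ this (abs_nonneg _) (hy i)
    · intro y hy z hz a b ha hb hab i
      calc |a * y i + b * z i| ≤ |a * y i| + |b * z i| := abs_add_le _ _
        _ = a * |y i| + b * |z i| := by rw [abs_mul, abs_mul, abs_of_nonneg ha, abs_of_nonneg hb]
        _ ≤ a * 1 + b * 1 := by
          gcongr
          · exact hy i
          · exact hz i
        _ = 1 := by linarith
    · intro i j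
      classical
      rw [Finsupp.single_apply]
      split_ifs <;> simp
    · rintro n E y ⟨-, A, -, m, -, h1, h2⟩ hy i
      have hdisj : ∀ k l, i ∈ E k → i ∈ E l → k = l := by
        intro k l hk hl
        rcases lt_trichotomy k l with h | h | h
        · exact absurd (h2 k l h i hk) (not_lt.2 (h1 l i hl))
        · exact h
        · exact absurd (h2 l k h i hl) (not_lt.2 (h1 k i hk))
      have hsum : |∑ k, (restrict (E k) (y k)) i| ≤ 1 := by
        by_cases hex : ∃ k, i ∈ E k
        · obtain ⟨k, hk⟩ := hex
          rw [Finset.sum_eq_single k]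
          · simpa [restrict, Finsupp.filter_apply, hk] using hy k i
          · intro l _ hl
            have : i ∉ E l := fun h => hl (hdisj l k h hk)
            simp [restrict, this]
          · simp
        · rw [Finset.sum_eq_zero]
          · simp
          · intro l _
            have : i ∉ E l := fun h => hex ⟨l, h⟩
            simp [restrict, this]
      have : ((1 / 2 : ℝ) • ∑ k, restrict (E k) (y k)) i
          = (1 / 2) * ∑ k, (restrict (E k) (y k)) i := by
        simp
      rw [this, abs_mul, abs_of_pos (by norm_num : (0 : ℝ) < 1 / 2)]
      linarith
  exact hx _ key i

theorem abs_le_tsirelsonNorm (M : Set (Set ℕ+)) (x : ℕ+ →₀ ℝ) (i : ℕ+) :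
    |x i| ≤ tsirelsonNorm M x := by
  refine le_csInf (absorbent_theta M).gauge_set_nonempty ?_
  rintro r ⟨hr, y, hy, rfl⟩
  have := abs_le_one_of_mem_theta M hy i
  have hr : 0 < r := hr
  simpa [abs_mul, abs_of_pos hr] using mul_le_mul_of_nonneg_left this hr.le

theorem tsirelsonNorm_nonneg (M : Set (Set ℕ+)) (x : ℕ+ →₀ ℝ) : 0 ≤ tsirelsonNorm M x :=
  gauge_nonneg x

theorem tsirelsonNorm_add_le (M : Set (Set ℕ+)) (x y : ℕ+ →₀ ℝ) :
    tsirelsonNorm M (x + y) ≤ tsirelsonNorm M x + tsirelsonNorm M y :=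
  gauge_add_le (isThetaLike_theta M).absConvex.2 (absorbent_theta M) x y

theorem tsirelsonNorm_smul (M : Set (Set ℕ+)) (a : ℝ) (x : ℕ+ →₀ ℝ) :
    tsirelsonNorm M (a • x) = |a| * tsirelsonNorm M x := by
  simpa [tsirelsonNorm] using gauge_smul (isThetaLike_theta M).absConvex.1 a x

theorem tsirelsonNorm_single_le (M : Set (Set ℕ+)) (i : ℕ+) (a : ℝ) :
    tsirelsonNorm M (Finsupp.single i a) ≤ |a| := by
  have h : Finsupp.single i a = a • Finsupp.single i (1 : ℝ) := by simp
  rw [h, tsirelsonNorm_smul]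
  exact mul_le_of_le_one_right (abs_nonneg _)
    (gauge_le_one_of_mem ((isThetaLike_theta M).single_mem i))

/-! ### The system `M_T` of subsets of `{1, 2, …}` associated with a tree `T` -/

/-- For a finite sequence `ν = (n₁, …, n_k)`, the set `{n₁, n₁ + n₂, …, n₁ + ⋯ + n_k}`. -/
def tildeFin (ν : List ℕ+) : Set ℕ+ :=
  {m | ∃ j < ν.length, (m : ℕ) = ((ν.take (j + 1)).map fun n : ℕ+ => (n : ℕ)).sum}

/-- For an infinite sequence `ν = (n₁, n₂, …)`, the set `{n₁, n₁ + n₂, …}`. -/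
def tildeInf (ν : ℕ → ℕ+) : Set ℕ+ :=
  {m | ∃ j : ℕ, (m : ℕ) = ∑ i ∈ Finset.range (j + 1), (ν i : ℕ)}

/-- `M_T`: all sets `ν̃` where `ν ∈ T`, or `ν` is an infinite branch of `T`, or `|ν| ≤ 3`. -/
def treeSystem (T : Descriptive.tree ℕ+) : Set (Set ℕ+) :=
  {A | (∃ ν : List ℕ+, (ν ∈ T ∨ ν.length ≤ 3) ∧ A = tildeFin ν) ∨
    ∃ ν ∈ branches T, A = tildeInf ν}

/-! ### The tree space `E_T` -/

/-- The non-empty finite sequences of zeros and ones. -/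
abbrev Node : Type := {η : List Bool // η ≠ []}

/-- The node `σ|_ℓ`, `ℓ ≥ 1`. -/
def node (σ : ℕ → Bool) (ℓ : ℕ+) : Node :=
  ⟨initSeg σ ℓ, by
    intro h
    have := length_initSeg σ ℓ
    rw [h] at this
    exact ℓ.ne_zero this.symm⟩

theorem node_injective (σ : ℕ → Bool) : Function.Injective (node σ) := by
  intro k l h
  have h2 : initSeg σ k = initSeg σ l := congrArg Subtype.val h
  have := congrArg List.length h2
  rw [length_initSeg, length_initSeg] at this
  exact PNat.coe_injective this

theorem exists_node_eq (η : Node) : ∃ σ ℓ, node σ ℓ = η := by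
  obtain ⟨η, hη⟩ := η
  refine ⟨fun i => η.getD i false, ⟨η.length, List.length_pos_of_ne_nil hη⟩, Subtype.ext ?_⟩
  apply List.ext_getElem
  · simp [node, initSeg]
  · intro i h1 h2
    simp [node, initSeg]

/-- The vector `∑_{ℓ ≥ 1} x(σ|_ℓ) e_ℓ` of `c₀₀`. -/
def alongBranch (σ : ℕ → Bool) : (Node →₀ ℝ) →ₗ[ℝ] (ℕ+ →₀ ℝ) :=
  Finsupp.lcomapDomain (node σ) (node_injective σ)

theorem alongBranch_apply (σ : ℕ → Bool) (x : Node →₀ ℝ) (ℓ : ℕ+) :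
    alongBranch σ x ℓ = x (node σ ℓ) := rfl

/-- The space `c₀₀` over the non-empty finite sequences of zeros and ones; a copy for each tree `T`,
as its norm depends on `T`. -/
def C00 (_T : Descriptive.tree (Bool × ℕ+)) : Type := Node →₀ ℝ

instance (T : Descriptive.tree (Bool × ℕ+)) : AddCommGroup (C00 T) :=
  inferInstanceAs (AddCommGroup (Node →₀ ℝ))

instance (T : Descriptive.tree (Bool × ℕ+)) : Module ℝ (C00 T) :=
  inferInstanceAs (Module ℝ (Node →₀ ℝ))

/-- `‖x‖_T`, the supremum over `σ` of `‖∑_{ℓ ≥ 1} x(σ|_ℓ) e_ℓ‖` in the norm given by `M_{T(σ)}`. -/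
def treeNorm (T : Descriptive.tree (Bool × ℕ+)) (x : Node →₀ ℝ) : ℝ :=
  ⨆ σ : ℕ → Bool, tsirelsonNorm (treeSystem (sect T σ)) (alongBranch σ x)

theorem bddAbove_treeNorm (T : Descriptive.tree (Bool × ℕ+)) (x : Node →₀ ℝ) :
    BddAbove (Set.range fun σ : ℕ → Bool =>
      tsirelsonNorm (treeSystem (sect T σ)) (alongBranch σ x)) := by
  suffices h : ∃ C, ∀ σ, tsirelsonNorm (treeSystem (sect T σ)) (alongBranch σ x) ≤ C by
    obtain ⟨C, hC⟩ := h
    exact ⟨C, by rintro _ ⟨σ, rfl⟩; exact hC σ⟩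
  induction x using Finsupp.induction_linear with
  | zero => exact ⟨0, fun σ => by rw [map_zero]; exact gauge_zero.le⟩
  | add x y hx hy =>
    obtain ⟨C, hC⟩ := hx
    obtain ⟨D, hD⟩ := hy
    refine ⟨C + D, fun σ => ?_⟩
    rw [map_add]
    exact (tsirelsonNorm_add_le _ _ _).trans (add_le_add (hC σ) (hD σ))
  | single η a =>
    refine ⟨|a|, fun σ => ?_⟩
    by_cases h : η ∈ Set.range (node σ)
    · obtain ⟨ℓ, rfl⟩ := h
      have : alongBranch σ (Finsupp.single (node σ ℓ) a) = Finsupp.single ℓ a :=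
        Finsupp.comapDomain_single _ _ _ _
      rw [this]
      exact tsirelsonNorm_single_le _ _ _
    · have : alongBranch σ (Finsupp.single η a) = 0 :=
        Finsupp.comapDomain_single_of_not_mem_range h _ _
      rw [this]
      exact gauge_zero.le.trans (abs_nonneg a)

theorem treeNorm_smul (T : Descriptive.tree (Bool × ℕ+)) (c : ℝ) (x : Node →₀ ℝ) :
    treeNorm T (c • x) = |c| * treeNorm T x := by
  simp only [treeNorm, map_smul, tsirelsonNorm_smul]
  rw [← Real.mul_iSup_of_nonneg (abs_nonneg c)]

theorem treeNorm_add_le (T : Descriptive.tree (Bool × ℕ+)) (x y : Node →₀ ℝ) :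
    treeNorm T (x + y) ≤ treeNorm T x + treeNorm T y := by
  refine ciSup_le fun σ => ?_
  rw [map_add]
  exact (tsirelsonNorm_add_le _ _ _).trans
    (add_le_add (le_ciSup (bddAbove_treeNorm T x) σ) (le_ciSup (bddAbove_treeNorm T y) σ))

theorem eq_zero_of_treeNorm_eq_zero (T : Descriptive.tree (Bool × ℕ+)) (x : Node →₀ ℝ)
    (h : treeNorm T x = 0) : x = 0 := by
  refine Finsupp.ext fun η => ?_
  obtain ⟨σ, ℓ, rfl⟩ := exists_node_eq η
  have h1 := abs_le_tsirelsonNorm (treeSystem (sect T σ)) (alongBranch σ x) ℓ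
  have h2 := h1.trans (le_ciSup (bddAbove_treeNorm T x) σ)
  exact abs_eq_zero.1 (le_antisymm (h2.trans h.le) (abs_nonneg _))

instance (T : Descriptive.tree (Bool × ℕ+)) : Norm (C00 T) := ⟨fun x => treeNorm T x⟩

theorem core (T : Descriptive.tree (Bool × ℕ+)) : NormedSpace.Core ℝ (C00 T) where
  norm_nonneg _ := Real.iSup_nonneg fun _ => tsirelsonNorm_nonneg _ _
  norm_smul c x := treeNorm_smul T c x
  norm_triangle x y := treeNorm_add_le T x y
  norm_eq_zero_iff x := by
    refine ⟨eq_zero_of_treeNorm_eq_zero T x, ?_⟩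
    rintro rfl
    have h := treeNorm_smul T 0 0
    rw [smul_zero, abs_zero, zero_mul] at h
    exact h

instance (T : Descriptive.tree (Bool × ℕ+)) : NormedAddCommGroup (C00 T) :=
  NormedAddCommGroup.ofCore (core T)

instance (T : Descriptive.tree (Bool × ℕ+)) : NormedSpace ℝ (C00 T) :=
  NormedSpace.ofCore (core T)

/-- The Banach space `E_T`: the completion of `c₀₀` in the norm `‖·‖_T`. -/
abbrev E (T : Descriptive.tree (Bool × ℕ+)) : Type := UniformSpace.Completion (C00 T)

end TreeSpace

end

/-!
The unit vectors of `ℓ₁` are recovered in `E_T^*` by testing a subsequence `y k` of the given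
functionals on blocks `z j` of `c₀₀` whose signed sums stay bounded by `2`, while `y k` is at least
`1 / 2` on its own block and almost vanishes on the others
(`exists_subseq_almost_biorthogonal`, `le_norm_sum_of_almost_biorthogonal`).

Almost biorthogonality has two sources. A fixed functional is small on blocks of high level since
the basis is shrinking (`exists_level_abs_le`); here it matters that `M_T` contains all
three-element sets. Later functionals are small on a fixed block by weak-star convergence.

The sums stay bounded along `σ` if a single sequence in `T(σ)` separates the blocks that do not
vanish along `σ`. Infinite branches of the sections `T(σ)` cannot in general be dominated by one
sequence `b` simultaneously for all `σ`, so the blocks are confined to a part of the Cantor space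
where they can. Testing a functional on the single coordinates of an almost norming vector turns it
into a measure on the Cantor space. A limit `μ` of these measures, normalized, exists by
compactness, and a capacity argument gives `b` such that the compact set of all `τ` with an infinite
branch of `T(τ)` below `b` has almost full measure (`exists_bound_lt_measure`). The restrictions of
the almost norming vectors to small clopen neighbourhoods of this compact set still carry most of
the value of infinitely many of the functionals. If the gaps between the levels of such blocks are
large with respect to `b`, then for every `σ` the last block which does not vanish along `σ` yields
a point of the compact set that agrees with `σ` for long enough to provide the separating sequence
(`treeNorm_sum_le_two`).
-/

namespace TreeSpace

/-! ### Coordinate restrictions and sums of blocks for a single system -/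

theorem zero_mem_theta (M : Set (Set ℕ+)) : (0 : ℕ+ →₀ ℝ) ∈ theta M := by
  obtain ⟨r, hr, h⟩ := theta_small M 0
  simpa using h 0 (by simpa using hr.le)

/-- `Θ_M` is stable under restriction to any set of coordinates: the canonical basis is
unconditional. -/
theorem filter_mem_theta (M : Set (Set ℕ+)) (P : ℕ+ → Prop) [DecidablePred P] {x : ℕ+ →₀ ℝ}
    (hx : x ∈ theta M) : x.filter P ∈ theta M := by
  have hT := isThetaLike_theta M
  have key : IsThetaLike M {x : ℕ+ →₀ ℝ | x.filter P ∈ theta M} := by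
    refine ⟨⟨?_, ?_⟩, ?_, ?_⟩
    · rintro a ha _ ⟨y, hy, rfl⟩
      change (a • y).filter P ∈ theta M
      rw [Finsupp.filter_smul]
      exact hT.absConvex.1 a ha (Set.smul_mem_smul_set hy)
    · intro y hy z hz a b ha hb hab
      change (a • y + b • z).filter P ∈ theta M
      rw [Finsupp.filter_add, Finsupp.filter_smul, Finsupp.filter_smul]
      exact hT.absConvex.2 hy hz ha hb hab
    · intro i
      change (Finsupp.single i (1 : ℝ)).filter P ∈ theta M
      by_cases h : P i
      · rw [Finsupp.filter_single_of_pos _ h]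
        exact hT.single_mem i
      · rw [Finsupp.filter_single_of_neg _ h]
        exact zero_mem_theta M
    · intro n E y hE hy
      have := hT.half_sum_mem n E (fun k => (y k).filter P) hE hy
      change ((1 / 2 : ℝ) • ∑ k, restrict (E k) (y k)).filter P ∈ theta M
      convert this using 1
      ext i
      by_cases h : P i <;> simp [restrict, Finsupp.filter_apply, Finsupp.finsetSum_apply, h]
  exact hx _ key

theorem tsirelsonNorm_filter_le (M : Set (Set ℕ+)) (P : ℕ+ → Prop) [DecidablePred P]
    (x : ℕ+ →₀ ℝ) : tsirelsonNorm M (x.filter P) ≤ tsirelsonNorm M x := by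
  refine le_csInf (absorbent_theta M).gauge_set_nonempty ?_
  rintro r ⟨hr, y, hy, rfl⟩
  refine gauge_le_of_mem (le_of_lt hr) ⟨y.filter P, filter_mem_theta M P hy, ?_⟩
  exact (Finsupp.filter_smul).symm

theorem mem_theta_of_tsirelsonNorm_lt_one {M : Set (Set ℕ+)} {x : ℕ+ →₀ ℝ}
    (hx : tsirelsonNorm M x < 1) : x ∈ theta M :=
  setOfPred_gauge_lt_one_subset_self (isThetaLike_theta M).absConvex.2 (zero_mem_theta M)
    (absorbent_theta M) hx

/-- The closed unit ball of `‖·‖_M` inherits from `Θ_M` the stability under halved admissible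
sums. -/
theorem tsirelsonNorm_half_sum_le {M : Set (Set ℕ+)} {n : ℕ} {E : Fin n → Finset ℕ+}
    (hE : Admissible M E) {x : Fin n → ℕ+ →₀ ℝ} (hx : ∀ k, tsirelsonNorm M (x k) ≤ 1) :
    tsirelsonNorm M ((1 / 2 : ℝ) • ∑ k, restrict (E k) (x k)) ≤ 1 := by
  refine le_of_forall_gt_imp_ge_of_dense fun a ha => ?_
  have ha0 : 0 < a := one_pos.trans ha
  have h := (isThetaLike_theta M).half_sum_mem n E (fun k => a⁻¹ • x k) hE fun k => by
    apply mem_theta_of_tsirelsonNorm_lt_one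
    rw [tsirelsonNorm_smul, abs_of_pos (inv_pos.2 ha0)]
    calc a⁻¹ * tsirelsonNorm M (x k) ≤ a⁻¹ * 1 := by gcongr; exact hx k
      _ < 1 := by rw [mul_one]; exact inv_lt_one_of_one_lt₀ ha
  refine gauge_le_of_mem ha0.le ⟨_, h, ?_⟩
  have : ∀ k, restrict (E k) (a⁻¹ • x k) = a⁻¹ • restrict (E k) (x k) := fun k =>
    Finsupp.filter_smul
  simp only [this, ← Finset.smul_sum]
  rw [smul_comm, smul_smul a, mul_inv_cancel₀ ha0.ne', one_smul]

/-- Blocks separated by elements of one member of `M` behave as in `c₀`, up to the factor `2`. -/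
theorem tsirelsonNorm_sum_le_two {M : Set (Set ℕ+)} {A : Set ℕ+} (hA : A ∈ M) {n : ℕ}
    {u : Fin n → ℕ+ →₀ ℝ} {L R : Fin n → ℕ} {m : Fin n → ℕ+}
    (hLR : ∀ j, L j < R j) (hu : ∀ j, tsirelsonNorm M (u j) ≤ 1)
    (hsupp : ∀ j i, u j i ≠ 0 → L j < (i : ℕ) ∧ (i : ℕ) ≤ R j)
    (hm : ∀ j, m j ∈ A) (hmL : ∀ j, (m j : ℕ) ≤ L j + 1)
    (hRm : ∀ i j, i < j → R i < (m j : ℕ)) :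
    tsirelsonNorm M (∑ j, u j) ≤ 2 := by
  let E : Fin n → Finset ℕ+ := fun j =>
    Finset.Icc (L j).succPNat (R j - 1).succPNat
  have hmem : ∀ j (i : ℕ+), i ∈ E j ↔ L j < (i : ℕ) ∧ (i : ℕ) ≤ R j := by
    intro j i
    have := hLR j
    simp only [E, Finset.mem_Icc, ← PNat.coe_le_coe, Nat.succPNat_coe]
    omega
  have hE : Admissible M E := by
    refine ⟨fun j => ⟨(L j).succPNat, ?_⟩, A, hA, m, hm, ?_, ?_⟩
    · have := hLR j
      rw [hmem, Nat.succPNat_coe]; omega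
    · intro k i hi
      have h1 := hmL k
      have h2 := (hmem k i).1 hi
      rw [← PNat.coe_le_coe]; omega
    · intro k l hkl i hi
      have h1 := hRm k l hkl
      have h2 := (hmem k i).1 hi
      rw [← PNat.coe_lt_coe]; omega
  have h := tsirelsonNorm_half_sum_le hE hu
  have hr : ∀ j, restrict (E j) (u j) = u j := fun j =>
    Finsupp.filter_eq_self_iff _ _ |>.2 fun i hi => (hmem j i).2 (hsupp j i hi)
  simp only [hr, tsirelsonNorm_smul] at h
  rw [abs_of_pos (by norm_num : (0 : ℝ) < 1 / 2)] at h
  linarith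

/-! ### The tree norm -/

theorem tsirelsonNorm_alongBranch_le (T : Descriptive.tree (Bool × ℕ+)) (σ : ℕ → Bool)
    (x : Node →₀ ℝ) :
    tsirelsonNorm (treeSystem (sect T σ)) (alongBranch σ x) ≤ treeNorm T x :=
  le_ciSup (bddAbove_treeNorm T x) σ

theorem treeNorm_nonneg (T : Descriptive.tree (Bool × ℕ+)) (x : Node →₀ ℝ) : 0 ≤ treeNorm T x :=
  Real.iSup_nonneg fun _ => tsirelsonNorm_nonneg _ _

theorem treeNorm_filter_le (T : Descriptive.tree (Bool × ℕ+)) (P : Node → Prop) [DecidablePred P]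
    (x : Node →₀ ℝ) : treeNorm T (x.filter P) ≤ treeNorm T x := by
  refine ciSup_le fun σ => ?_
  have : alongBranch σ (x.filter P) = (alongBranch σ x).filter fun ℓ => P (node σ ℓ) := by
    ext ℓ
    simp only [alongBranch_apply, Finsupp.filter_apply]
  rw [this]
  exact (tsirelsonNorm_filter_le _ _ _).trans (tsirelsonNorm_alongBranch_le T σ x)

theorem abs_le_treeNorm (T : Descriptive.tree (Bool × ℕ+)) (x : Node →₀ ℝ) (η : Node) :
    |x η| ≤ treeNorm T x := by
  obtain ⟨σ, ℓ, rfl⟩ := exists_node_eq η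
  exact (abs_le_tsirelsonNorm _ (alongBranch σ x) ℓ).trans (tsirelsonNorm_alongBranch_le T σ x)

theorem length_node (σ : ℕ → Bool) (ℓ : ℕ+) : (node σ ℓ).1.length = ℓ := length_initSeg σ ℓ

theorem exists_level_bound (x : Node →₀ ℝ) (L : ℕ) :
    ∃ R, L < R ∧ ∀ η, x η ≠ 0 → η.1.length ≤ R :=
  ⟨max (L + 1) (x.support.sup fun η => η.1.length), by omega, fun η hη =>
    le_max_of_le_right (Finset.le_sup (f := fun η : Node => η.1.length)
      (Finsupp.mem_support_iff.2 hη))⟩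

/-- Three successive blocks behave as in `c₀`, up to the factor `2`: every three-element set
belongs to every system `M_T`. -/
theorem treeNorm_add_add_le_two (T : Descriptive.tree (Bool × ℕ+)) {x y z : Node →₀ ℝ}
    {K L N : ℕ} (hx : treeNorm T x ≤ 1) (hy : treeNorm T y ≤ 1) (hz : treeNorm T z ≤ 1)
    (hKL : K < L) (hLN : L < N)
    (hxs : ∀ η, x η ≠ 0 → K < η.1.length ∧ η.1.length ≤ L)
    (hys : ∀ η, y η ≠ 0 → L < η.1.length ∧ η.1.length ≤ N)
    (hzs : ∀ η, z η ≠ 0 → N < η.1.length) :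
    treeNorm T (x + y + z) ≤ 2 := by
  obtain ⟨R, hNR, hR⟩ := exists_level_bound z N
  refine ciSup_le fun σ => ?_
  have hA : tildeFin [K.succPNat, (L - K - 1).succPNat, (N - L - 1).succPNat] ∈
      treeSystem (sect T σ) := Or.inl ⟨_, Or.inr (by simp), rfl⟩
  have h := tsirelsonNorm_sum_le_two hA
    (u := ![alongBranch σ x, alongBranch σ y, alongBranch σ z])
    (L := ![K, L, N]) (R := ![L, N, R])
    (m := ![K.succPNat, L.succPNat, N.succPNat])
    (by intro j; fin_cases j <;> simp [*])
    (by
      intro j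
      fin_cases j
      · exact (tsirelsonNorm_alongBranch_le T σ x).trans hx
      · exact (tsirelsonNorm_alongBranch_le T σ y).trans hy
      · exact (tsirelsonNorm_alongBranch_le T σ z).trans hz)
    (by
      intro j i hi
      rw [← length_node σ i]
      fin_cases j
      · exact hxs _ hi
      · exact hys _ hi
      · exact ⟨hzs _ hi, hR _ hi⟩)
    (by
      intro j
      fin_cases j
      · exact ⟨0, by simp, by simp⟩
      · exact ⟨1, by simp, by simp; omega⟩
      · exact ⟨2, by simp, by simp; omega⟩)
    (by intro j; fin_cases j <;> exact le_rfl)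
    (by
      intro i j hij
      fin_cases i <;> fin_cases j <;> simp at hij ⊢
      all_goals omega)
  simpa [Fin.sum_univ_three, add_assoc] using h

theorem treeNorm_neg (T : Descriptive.tree (Bool × ℕ+)) (x : Node →₀ ℝ) :
    treeNorm T (-x) = treeNorm T x := by
  simpa using treeNorm_smul T (-1) x

/-- The canonical basis of `E_T` is shrinking: a bounded functional is small on vectors supported on
high levels. If `d` bounds the functional on the vectors of norm at most one above some level, then
so does `3 / 4 * d` above a higher one, as half the sum of three successive such vectors is
another. -/
theorem exists_level_abs_le (T : Descriptive.tree (Bool × ℕ+)) (f : (Node →₀ ℝ) →ₗ[ℝ] ℝ)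
    (hf : ∀ v, |f v| ≤ treeNorm T v) {ε : ℝ} (hε : 0 < ε) :
    ∃ L : ℕ, ∀ v, treeNorm T v ≤ 1 → (∀ η, v η ≠ 0 → L < η.1.length) → |f v| ≤ ε := by
  have key : ∀ n : ℕ, ∃ L : ℕ, ∀ v, treeNorm T v ≤ 1 → (∀ η, v η ≠ 0 → L < η.1.length) →
      f v ≤ (3 / 4 : ℝ) ^ n := by
    intro n
    induction n with
    | zero => exact ⟨0, fun v hv _ => by simpa using (le_abs_self _).trans ((hf v).trans hv)⟩
    | succ n ih =>
      obtain ⟨K, hK⟩ := ih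
      by_contra! hcon
      obtain ⟨x, hx, hxs, hfx⟩ := hcon K
      obtain ⟨L, hKL, hxL⟩ := exists_level_bound x K
      obtain ⟨y, hy, hys, hfy⟩ := hcon L
      obtain ⟨N, hLN, hyN⟩ := exists_level_bound y L
      obtain ⟨z, hz, hzs, hfz⟩ := hcon N
      have h2 := treeNorm_add_add_le_two T hx hy hz hKL hLN (fun η h => ⟨hxs η h, hxL η h⟩)
        (fun η h => ⟨hys η h, hyN η h⟩) hzs
      have h3 := hK ((1 / 2 : ℝ) • (x + y + z))
        (by rw [treeNorm_smul, abs_of_pos (by norm_num : (0 : ℝ) < 1 / 2)]; linarith)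
        (by
          intro η hη
          by_contra hle
          apply hη
          have h1 : x η = 0 := by by_contra h; exact hle (hxs η h)
          have h2 : y η = 0 := by by_contra h; exact hle (hKL.trans (hys η h))
          have h3 : z η = 0 := by by_contra h; exact hle ((hKL.trans hLN).trans (hzs η h))
          simp [h1, h2, h3])
      rw [map_smul, map_add, map_add, smul_eq_mul] at h3
      rw [pow_succ] at hfx hfy hfz
      have : (0 : ℝ) < (3 / 4) ^ n := by positivity
      linarith
  obtain ⟨n, hn⟩ := exists_pow_lt_of_lt_one hε (by norm_num : (3 / 4 : ℝ) < 1)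
  obtain ⟨L, hL⟩ := key n
  refine ⟨L, fun v hv hs => abs_le.2 ⟨?_, (hL v hv hs).trans hn.le⟩⟩
  have := hL (-v) (by rwa [treeNorm_neg]) (fun η hη => hs η (by simpa using hη))
  rw [map_neg] at this
  linarith

/-! ### Bounded branches on sets of large measure -/

open MeasureTheory

/-- The set of all `τ` for which the section `T(τ)` has an infinite branch dominated by `b`. -/
def boundedSet (T : Descriptive.tree (Bool × ℕ+)) (b : ℕ → ℕ+) : Set (ℕ → Bool) :=
  {τ | ∃ ν ∈ branches (sect T τ), ∀ i, ν i ≤ b i}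

/-- The set of all `σ` whose initial segment of length `n` is an initial segment of an element of
`boundedSet T b`. These clopen sets decrease to the compact set `boundedSet T b`. -/
def boundedNhd (T : Descriptive.tree (Bool × ℕ+)) (b : ℕ → ℕ+) (n : ℕ) : Set (ℕ → Bool) :=
  {σ | ∃ τ ∈ boundedSet T b, initSeg τ n = initSeg σ n}

theorem mem_branches_sect {T : Descriptive.tree (Bool × ℕ+)} {τ : ℕ → Bool} {ν : ℕ → ℕ+} :
    ν ∈ branches (sect T τ) ↔ ∀ ℓ, List.zip (initSeg τ ℓ) (initSeg ν ℓ) ∈ T := by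
  have : ∀ ℓ, initSeg ν ℓ ∈ sect T τ ↔ List.zip (initSeg τ ℓ) (initSeg ν ℓ) ∈ T := fun ℓ => by
    change List.zip (initSeg τ (initSeg ν ℓ).length) (initSeg ν ℓ) ∈ T ↔ _
    rw [length_initSeg]
  exact forall_congr' this

theorem isClopen_setOf_initSeg {A : Type*} [TopologicalSpace A] [DiscreteTopology A]
    (S : Set (List A)) (n : ℕ) : IsClopen {σ : ℕ → A | initSeg σ n ∈ S} := by
  have hc : Continuous fun (σ : ℕ → A) (i : Fin n) => σ i := by fun_prop
  exact (isClopen_discrete {g : Fin n → A | List.ofFn g ∈ S}).preimage hc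

theorem isClopen_boundedNhd (T : Descriptive.tree (Bool × ℕ+)) (b : ℕ → ℕ+) (n : ℕ) :
    IsClopen (boundedNhd T b n) :=
  isClopen_setOf_initSeg {η | ∃ τ ∈ boundedSet T b, initSeg τ n = η} n

theorem isClosed_setOf_zip_mem (T : Descriptive.tree (Bool × ℕ+)) (n : ℕ) :
    IsClosed {p : (ℕ → Bool) × (ℕ → ℕ+) | List.zip (initSeg p.1 n) (initSeg p.2 n) ∈ T} := by
  have hc : Continuous fun p : (ℕ → Bool) × (ℕ → ℕ+) =>
      ((fun i : Fin n => p.1 i, fun i : Fin n => p.2 i) : (Fin n → Bool) × (Fin n → ℕ+)) := by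
    fun_prop
  exact (isClosed_discrete {g : (Fin n → Bool) × (Fin n → ℕ+) |
    List.zip (List.ofFn g.1) (List.ofFn g.2) ∈ T}).preimage hc

/-- Branches dominated by `b` on a long initial segment are enough to be in the clopen set
`boundedNhd T b n`, by compactness of `{ν | ν ≤ b}`. -/
theorem exists_subset_boundedNhd (T : Descriptive.tree (Bool × ℕ+)) (b : ℕ → ℕ+) (n : ℕ) :
    ∃ j, {σ | ∃ ν ∈ branches (sect T σ), ∀ i < j, ν i ≤ b i} ⊆ boundedNhd T b n := by
  by_contra! hcon
  let F : ℕ → Set ((ℕ → Bool) × (ℕ → ℕ+)) := fun j =>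
    {p | List.zip (initSeg p.1 j) (initSeg p.2 j) ∈ T} ∩
      (boundedNhd T b n)ᶜ ×ˢ Set.univ.pi fun i => Set.Iic (b i)
  have hcpt : IsCompact ((boundedNhd T b n)ᶜ ×ˢ Set.univ.pi fun i => Set.Iic (b i)) :=
    (isClopen_boundedNhd T b n).compl.isClosed.isCompact.prod
      (isCompact_univ_pi fun i => (Set.finite_Iic (b i)).isCompact)
  have hcl : ∀ j, IsClosed (F j) := fun j => (isClosed_setOf_zip_mem T j).inter hcpt.isClosed
  obtain ⟨⟨τ, ν⟩, h⟩ := IsCompact.nonempty_iInter_of_sequence_nonempty_isCompact_isClosed F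
    (by
      rintro j ⟨τ, ν⟩ ⟨h1, h2⟩
      refine ⟨?_, h2⟩
      have h1' : List.zip (initSeg τ (j + 1)) (initSeg ν (j + 1)) ∈ T := h1
      rw [initSeg_succ, initSeg_succ, List.zip_append (by simp [length_initSeg])] at h1'
      exact Descriptive.Tree.mem_of_append h1')
    (by
      intro j
      obtain ⟨σ, ⟨ν, hν, hb⟩, hσ⟩ := Set.not_subset.1 (hcon j)
      -- beyond `j`, the branch is replaced by `b`
      refine ⟨(σ, fun i => if i < j then ν i else b i), ?_, hσ, ?_⟩
      · have h := mem_branches_sect.1 hν j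
        have he : initSeg (fun i => if i < j then ν i else b i) j = initSeg ν j := by
          simp [initSeg]
        change List.zip (initSeg σ j) (initSeg _ j) ∈ T
        rwa [he]
      · intro i _
        change (if i < j then ν i else b i) ≤ b i
        split_ifs with hij
        exacts [hb i hij, le_rfl])
    (hcpt.of_isClosed_subset (hcl 0) Set.inter_subset_right) hcl
  rw [Set.mem_iInter] at h
  exact (h 0).2.1 ⟨τ, ⟨ν, mem_branches_sect.2 fun ℓ => (h ℓ).1,
    fun i => (h 0).2.2 i (Set.mem_univ i)⟩, rfl⟩

/-- A capacity argument: the entries of the bound `b` are chosen one after the other, using that an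
outer measure is continuous along increasing sequences of arbitrary sets. -/
theorem exists_bound_lt_measure {T : Descriptive.tree (Bool × ℕ+)}
    (hT : ∀ σ : ℕ → Bool, IllFounded (sect T σ)) (μ : Measure (ℕ → Bool)) [IsProbabilityMeasure μ]
    {c : ENNReal} (hc : c < 1) : ∃ b : ℕ → ℕ+, ∀ n, c < μ (boundedNhd T b n) := by
  let A : ℕ → (ℕ → ℕ+) → Set (ℕ → Bool) := fun j b =>
    {σ | ∃ ν ∈ branches (sect T σ), ∀ i < j, ν i ≤ b i}
  have step : ∀ (j : ℕ) (b : ℕ → ℕ+), ∃ m : ℕ+, c < μ (A j b) →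
      c < μ (A (j + 1) (Function.update b j m)) := by
    intro j b
    have hmono : Monotone fun m : ℕ+ => A (j + 1) (Function.update b j m) := by
      rintro m m' hmm σ ⟨ν, hν, h⟩
      refine ⟨ν, hν, fun i hi => (h i hi).trans ?_⟩
      rcases eq_or_ne i j with rfl | hij
      · simpa only [Function.update_self] using hmm
      · simp only [Function.update_of_ne hij, le_refl]
    have hunion : A j b ⊆ ⋃ m : ℕ+, A (j + 1) (Function.update b j m) := by
      rintro σ ⟨ν, hν, h⟩
      refine Set.mem_iUnion.2 ⟨ν j, ν, hν, fun i hi => ?_⟩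
      rcases Nat.lt_succ_iff_lt_or_eq.1 hi with hi | rfl
      · rw [Function.update_of_ne hi.ne]
        exact h i hi
      · rw [Function.update_self]
    by_cases hA : c < μ (A j b)
    · have h := hA.trans_le (measure_mono hunion)
      rw [hmono.measure_iUnion, lt_iSup_iff] at h
      exact ⟨h.choose, fun _ => h.choose_spec⟩
    · exact ⟨1, fun h => absurd h hA⟩
  choose g hg using step
  let B : ℕ → ℕ → ℕ+ := fun j => Nat.rec (fun _ => 1) (fun j b => Function.update b j (g j b)) j
  have hB : ∀ j, B (j + 1) = Function.update (B j) j (g j (B j)) := fun _ => rfl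
  have hAB : ∀ j, c < μ (A j (B j)) := by
    intro j
    induction j with
    | zero =>
      have : A 0 (B 0) = Set.univ := Set.eq_univ_of_forall fun σ =>
        ⟨(hT σ).some, (hT σ).some_mem, fun i hi => absurd hi (Nat.not_lt_zero i)⟩
      rwa [this, measure_univ]
    | succ j ih => exact hg j (B j) ih
  have hstab : ∀ i j, i < j → B j i = B (i + 1) i := by
    intro i j hij
    induction j, hij using Nat.le_induction with
    | base => rfl
    | succ j hj ih => rw [hB, Function.update_of_ne (by omega), ih]
  refine ⟨fun i => B (i + 1) i, fun n => ?_⟩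
  obtain ⟨j, hj⟩ := exists_subset_boundedNhd T (fun i => B (i + 1) i) n
  refine ((hAB j).trans_le (measure_mono ?_)).trans_le (measure_mono hj)
  rintro σ ⟨ν, hν, h⟩
  exact ⟨ν, hν, fun i hi => (h i hi).trans (hstab i j hi).le⟩

/-- One bound works for infinitely many members of a sequence of probability measures: it is
obtained from a limit of the sequence along an ultrafilter. -/
theorem exists_bound_frequently_lt {T : Descriptive.tree (Bool × ℕ+)}
    (hT : ∀ σ : ℕ → Bool, IllFounded (sect T σ)) (P : ℕ → ProbabilityMeasure (ℕ → Bool))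
    {c : ENNReal} (hc : c < 1) :
    ∃ b : ℕ → ℕ+, ∀ n, ∃ᶠ k in atTop, c < (P k : Measure (ℕ → Bool)) (boundedNhd T b n) := by
  have hlim := ((hyperfilter ℕ).map P).le_nhds_lim
  obtain ⟨b, hb⟩ := exists_bound_lt_measure hT
    (((hyperfilter ℕ).map P).lim : Measure (ℕ → Bool)) hc
  refine ⟨b, fun n => ?_⟩
  have h := ProbabilityMeasure.tendsto_measure_of_null_frontier_of_tendsto'
    (show Tendsto P (hyperfilter ℕ) (𝓝 ((hyperfilter ℕ).map P).lim) from hlim)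
    (E := boundedNhd T b n) (by rw [(isClopen_boundedNhd T b n).frontier_eq, measure_empty])
  exact ((h.eventually_const_lt (hb n)).frequently).filter_mono Nat.hyperfilter_le_atTop

/-- The finitely supported case of `exists_bound_frequently_lt`, for weights which need not be
normalized. -/
theorem exists_bound_frequently_lt_sum {T : Descriptive.tree (Bool × ℕ+)}
    (hT : ∀ σ : ℕ → Bool, IllFounded (sect T σ)) {ι : Type*} (p : ι → ℕ → Bool)
    (s : ℕ → Finset ι) (w : ℕ → ι → ℝ) (hw : ∀ k, ∀ i ∈ s k, 0 ≤ w k i)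
    (hpos : ∀ k, 0 < ∑ i ∈ s k, w k i) {c : ℝ} (hc0 : 0 ≤ c) (hc : c < 1) :
    ∃ b : ℕ → ℕ+, ∀ n, ∃ᶠ k in atTop,
      c * ∑ i ∈ s k, w k i < ∑ i ∈ s k, (boundedNhd T b n).indicator (fun _ => w k i) (p i) := by
  let μ : ℕ → Measure (ℕ → Bool) := fun k =>
    ∑ i ∈ s k, ENNReal.ofReal (w k i / ∑ j ∈ s k, w k j) • Measure.dirac (p i)
  have hμ : ∀ k (U : Set (ℕ → Bool)), MeasurableSet U → μ k U =
      ENNReal.ofReal ((∑ i ∈ s k, U.indicator (fun _ => w k i) (p i)) / ∑ j ∈ s k, w k j) := by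
    intro k U hU
    rw [Finset.sum_div, ENNReal.ofReal_sum_of_nonneg]
    · simp only [μ, Measure.finsetSum_apply, Measure.smul_apply, smul_eq_mul,
        Measure.dirac_apply' _ hU]
      refine Finset.sum_congr rfl fun i _ => ?_
      by_cases h : p i ∈ U <;> simp [h]
    · intro i hi
      refine div_nonneg (Set.indicator_nonneg (fun _ _ => hw k i hi) _) (hpos k).le
  have hprob : ∀ k, IsProbabilityMeasure (μ k) := fun k => ⟨by
    rw [hμ k _ MeasurableSet.univ]
    simp [div_self (hpos k).ne']⟩
  obtain ⟨b, hb⟩ := exists_bound_frequently_lt hT (fun k => ⟨μ k, hprob k⟩)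
    (c := ENNReal.ofReal c) (by simpa using hc)
  refine ⟨b, fun n => (hb n).mono fun k hk => ?_⟩
  change ENNReal.ofReal c < μ k _ at hk
  rw [hμ k _ (isClopen_boundedNhd T b n).isOpen.measurableSet,
    ENNReal.ofReal_lt_ofReal_iff_of_nonneg hc0,
    lt_div_iff₀ (hpos k)] at hk
  exact hk

/-! ### Sums of blocks along bounded branches -/

/-- The extension of a finite sequence by zeros. -/
def extend (η : Node) : ℕ → Bool := fun i => η.1.getD i false

theorem initSeg_extend_node (σ : ℕ → Bool) {ℓ : ℕ+} {n : ℕ} (h : n ≤ ℓ) :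
    initSeg (extend (node σ ℓ)) n = initSeg σ n := by
  apply List.ext_getElem
  · simp [length_initSeg]
  · intro i h1 h2
    have hi : i < ℓ := by rw [length_initSeg] at h2; omega
    simp [extend, node, initSeg, hi]

theorem mem_tildeFin_initSeg (ν : ℕ → ℕ+) {n p : ℕ} (hp : p < n) {m : ℕ+}
    (hm : (m : ℕ) = ∑ i ∈ Finset.range (p + 1), (ν i : ℕ)) : m ∈ tildeFin (initSeg ν n) := by
  refine ⟨p, by rwa [length_initSeg], ?_⟩
  have : (initSeg ν n).take (p + 1) = initSeg ν (p + 1) := by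
    apply List.ext_getElem
    · simp [length_initSeg]; omega
    · intro i h1 h2
      simp only [initSeg, List.getElem_take, List.getElem_ofFn]
  rw [this, hm, initSeg, List.map_ofFn, List.sum_ofFn,
    ← Fin.sum_univ_eq_sum_range fun i => (ν i : ℕ)]
  rfl

theorem initSeg_mem_sect {T : Descriptive.tree (Bool × ℕ+)} {σ τ : ℕ → Bool} {ν : ℕ → ℕ+} {n : ℕ}
    (hν : ν ∈ branches (sect T τ)) (h : initSeg τ n = initSeg σ n) : initSeg ν n ∈ sect T σ := by
  have := mem_branches_sect.1 hν n
  change List.zip (initSeg σ (initSeg ν n).length) (initSeg ν n) ∈ T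
  rwa [length_initSeg, ← h]

theorem succ_le_sum_range (ν : ℕ → ℕ+) (r : ℕ) :
    r + 1 ≤ ∑ i ∈ Finset.range (r + 1), (ν i : ℕ) := by
  simpa using Finset.card_nsmul_le_sum (Finset.range (r + 1)) (fun i => (ν i : ℕ)) 1
    fun i _ => (ν i).pos

/-- Blocks which live near `boundedSet T b` behave as in `c₀`, up to the factor `2`, if the gaps
between their levels are large with respect to `b`. For a given `σ`, the last block which does not
vanish along `σ` provides a point of `boundedSet T b` close to `σ`, hence a finite sequence in
`T(σ)` that has a partial sum in each of the preceding gaps. -/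
theorem treeNorm_sum_le_two {T : Descriptive.tree (Bool × ℕ+)} {b : ℕ → ℕ+} {L R : ℕ → ℕ}
    {z : ℕ → Node →₀ ℝ} (hLR : ∀ j, L j < R j) (hz : ∀ j, treeNorm T (z j) ≤ 1)
    (hlev : ∀ j η, z j η ≠ 0 → L j < η.1.length ∧ η.1.length ≤ R j)
    (hnhd : ∀ j η, z j η ≠ 0 → extend η ∈ boundedNhd T b (L j))
    (hb0 : ∀ j, (b 0 : ℕ) ≤ L j)
    (hgap : ∀ i j, i < j → ∑ l ∈ Finset.range (R i + 1), (b l : ℕ) ≤ L j) (n : ℕ) :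
    treeNorm T (∑ j ∈ Finset.range n, z j) ≤ 2 := by
  refine ciSup_le fun σ => ?_
  rw [map_sum]
  induction n with
  | zero =>
    rw [Finset.sum_range_zero]
    exact gauge_zero.le.trans zero_le_two
  | succ n ih =>
    by_cases h0 : alongBranch σ (z n) = 0
    · rwa [Finset.sum_range_succ, h0, add_zero]
    obtain ⟨ℓ, hℓ⟩ := Finsupp.ne_iff.1 h0
    have hℓL := (hlev n _ hℓ).1
    rw [length_node] at hℓL
    obtain ⟨τ, ⟨ν, hν, hνb⟩, hτ⟩ := hnhd n _ hℓ
    rw [initSeg_extend_node σ hℓL.le] at hτ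
    have hRL : ∀ i j, i < j → R i < L j := fun i j hij =>
      (Nat.lt_of_succ_le (succ_le_sum_range b (R i))).trans_le (hgap i j hij)
    -- the separating element in front of the `j`-th block is the partial sum of index `p j`
    let p : ℕ → ℕ := fun j => if j = 0 then 0 else R (j - 1)
    have hpb : ∀ j, ∑ i ∈ Finset.range (p j + 1), (ν i : ℕ) ≤ L j := by
      intro j
      have h1 : ∑ i ∈ Finset.range (p j + 1), (ν i : ℕ) ≤ ∑ i ∈ Finset.range (p j + 1), (b i : ℕ) :=
        Finset.sum_le_sum fun i _ => hνb i
      refine h1.trans ?_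
      by_cases hj : j = 0
      · simpa [p, hj] using hb0 0
      · simpa [p, hj] using hgap (j - 1) j (by omega)
    have hL : ∀ j, j ≤ n → L j ≤ L n := fun j hj => by
      rcases hj.lt_or_eq with h | rfl
      exacts [((hLR j).trans (hRL j n h)).le, le_rfl]
    have hpL : ∀ j, j ≤ n → p j < L n := fun j hj =>
      ((Nat.lt_of_succ_le (succ_le_sum_range ν (p j))).trans_le (hpb j)).trans_le (hL j hj)
    have hpR : ∀ i j, i < j → R i ≤ p j := by
      intro i j hij
      have hj : j ≠ 0 := by omega
      simp only [p, hj, if_false]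
      rcases (Nat.le_sub_one_of_lt hij).lt_or_eq with h | h
      · exact ((hRL _ _ h).trans (hLR _)).le
      · rw [h]
    rw [Finset.sum_range]
    refine tsirelsonNorm_sum_le_two (A := tildeFin (initSeg ν (L n))) (L := fun j => L j)
      (R := fun j => R j)
      (m := fun j => ⟨∑ i ∈ Finset.range (p j + 1), (ν i : ℕ),
        (Nat.succ_pos _).trans_le (succ_le_sum_range ν (p j))⟩)
      (Or.inl ⟨_, Or.inl (initSeg_mem_sect hν hτ), rfl⟩) (fun j => hLR j)
      (fun j => (tsirelsonNorm_alongBranch_le T σ _).trans (hz j))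
      (fun j i hi => ?_) (fun j => ?_) (fun j => (hpb j).trans (Nat.le_succ _)) fun i j hij => ?_
    · rw [← length_node σ i]
      exact hlev j _ hi
    · exact mem_tildeFin_initSeg ν (hpL j (Nat.le_of_lt_succ j.2)) rfl
    · exact Nat.lt_of_le_of_lt (hpR i j hij) (Nat.lt_of_succ_le (succ_le_sum_range ν (p j)))

/-! ### The choice of the subsequence -/

theorem apply_eq_sum (f : (Node →₀ ℝ) →ₗ[ℝ] ℝ) (v : Node →₀ ℝ) :
    f v = ∑ η ∈ v.support, v η * f (Finsupp.single η 1) := by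
  conv_lhs => rw [← Finsupp.sum_single v]
  rw [Finsupp.sum, map_sum]
  refine Finset.sum_congr rfl fun η _ => ?_
  rw [← smul_eq_mul, ← map_smul, Finsupp.smul_single_one]

theorem apply_filter_eq_sum (f : (Node →₀ ℝ) →ₗ[ℝ] ℝ) (v : Node →₀ ℝ) (P : Node → Prop)
    [DecidablePred P] :
    f (v.filter P) = ∑ η ∈ v.support, if P η then v η * f (Finsupp.single η 1) else 0 := by
  rw [apply_eq_sum, Finsupp.support_filter, Finset.sum_filter]
  refine Finset.sum_congr rfl fun η _ => ?_
  by_cases h : P η <;> simp [h]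

/-- A functional is normed by vectors all of whose coordinates contribute non-negatively. -/
theorem exists_apply_single_nonneg (T : Descriptive.tree (Bool × ℕ+)) (f : (Node →₀ ℝ) →ₗ[ℝ] ℝ)
    (v : Node →₀ ℝ) : ∃ y, treeNorm T y ≤ treeNorm T v ∧ f v ≤ f y ∧
      ∀ η, 0 ≤ y η * f (Finsupp.single η 1) := by
  classical
  refine ⟨v.filter fun η => 0 ≤ v η * f (Finsupp.single η 1), treeNorm_filter_le T _ v, ?_, ?_⟩
  · rw [apply_filter_eq_sum, apply_eq_sum]
    refine Finset.sum_le_sum fun η _ => ?_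
    split_ifs with h
    exacts [le_rfl, (not_le.1 h).le]
  · intro η
    rw [Finsupp.filter_apply]
    split_ifs with h
    exacts [h, by simp]

theorem finite_setOf_length_le (L : ℕ) : {η : Node | η.1.length ≤ L}.Finite :=
  (List.finite_length_le Bool L).preimage Subtype.val_injective.injOn

/-- A pointwise null sequence of functionals converges to zero uniformly on the bounded vectors
supported on finitely many levels. -/
theorem eventually_abs_le_of_level_le (T : Descriptive.tree (Bool × ℕ+))
    {f : ℕ → (Node →₀ ℝ) →ₗ[ℝ] ℝ} (hnull : ∀ v, Tendsto (fun k => f k v) atTop (𝓝 0)) (L : ℕ)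
    {ε : ℝ} (hε : 0 < ε) :
    ∀ᶠ k in atTop, ∀ v, treeNorm T v ≤ 1 → (∀ η, v η ≠ 0 → η.1.length ≤ L) → |f k v| ≤ ε := by
  let S := (finite_setOf_length_le L).toFinset
  have hS : Tendsto (fun k => ∑ η ∈ S, |f k (Finsupp.single η 1)|) atTop (𝓝 0) := by
    have h : ∀ η ∈ S, Tendsto (fun k => |f k (Finsupp.single η 1)|) atTop (𝓝 0) := fun η _ => by
      simpa using (hnull (Finsupp.single η 1)).abs
    simpa using tendsto_finsetSum S h
  filter_upwards [hS.eventually_lt_const hε] with k hk v hv hvL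
  rw [apply_eq_sum]
  calc |∑ η ∈ v.support, v η * f k (Finsupp.single η 1)|
      ≤ ∑ η ∈ v.support, |v η * f k (Finsupp.single η 1)| := Finset.abs_sum_le_sum_abs _ _
    _ ≤ ∑ η ∈ v.support, |f k (Finsupp.single η 1)| := by
      refine Finset.sum_le_sum fun η _ => ?_
      rw [abs_mul]
      exact mul_le_of_le_one_left (abs_nonneg _) ((abs_le_treeNorm T v η).trans hv)
    _ ≤ ∑ η ∈ S, |f k (Finsupp.single η 1)| := by
      refine Finset.sum_le_sum_of_subset_of_nonneg (fun η hη => ?_) fun _ _ _ => abs_nonneg _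
      exact (finite_setOf_length_le L).mem_toFinset.2 (hvL η (Finsupp.mem_support_iff.1 hη))
    _ ≤ ε := hk.le

/-- The data of one step in the choice of the subsequence: the index `k` of a functional, a block
`z` supported on the levels in `(L, R]` on which this functional is large, and a number `n` which
determines how small the other functionals have to be on `z`. -/
structure Block where
  n : ℕ
  k : ℕ
  L : ℕ
  R : ℕ
  z : Node →₀ ℝ

/-- A pointwise null sequence of functionals whose norms exceed `9 / 10` has a subsequence which is
almost biorthogonal to a sequence of blocks whose signed sums are bounded by `2`. -/
theorem exists_subseq_almost_biorthogonal {T : Descriptive.tree (Bool × ℕ+)}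
    (hT : ∀ σ : ℕ → Bool, IllFounded (sect T σ)) {f : ℕ → (Node →₀ ℝ) →ₗ[ℝ] ℝ}
    (hf : ∀ k v, |f k v| ≤ treeNorm T v) (hnorm : ∀ k, ∃ v, treeNorm T v ≤ 1 ∧ 9 / 10 < f k v)
    (hnull : ∀ v, Tendsto (fun k => f k v) atTop (𝓝 0)) :
    ∃ (φ : ℕ → ℕ) (z : ℕ → Node →₀ ℝ), StrictMono φ ∧ (∀ j, 1 / 2 ≤ f (φ j) (z j)) ∧
      (∀ j k, j ≠ k → |f (φ k) (z j)| ≤ 1 / 40 * (1 / 2) ^ j) ∧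
      ∀ c : ℕ → ℝ, (∀ j, |c j| ≤ 1) →
        ∀ n, treeNorm T (∑ j ∈ Finset.range n, c j • z j) ≤ 2 := by
  classical
  have hy : ∀ k, ∃ y, treeNorm T y ≤ 1 ∧ 9 / 10 < f k y ∧
      ∀ η, 0 ≤ y η * f k (Finsupp.single η 1) := by
    intro k
    obtain ⟨v, hv, hfv⟩ := hnorm k
    obtain ⟨y, hy, hfy, hy0⟩ := exists_apply_single_nonneg T (f k) v
    exact ⟨y, hy.trans hv, hfv.trans_le hfy, hy0⟩
  choose y hy hfy hy0 using hy
  -- the functional `f k`, tested on the coordinates of `y k`, is a measure on the Cantor space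
  obtain ⟨b, hb⟩ := exists_bound_frequently_lt_sum hT extend (fun k => (y k).support)
    (fun k η => y k η * f k (Finsupp.single η 1)) (fun k η _ => hy0 k η)
    (fun k => by rw [← apply_eq_sum]; linarith [hfy k]) (c := 3 / 4) (by norm_num) (by norm_num)
  have hb' : ∀ n, ∃ᶠ k in atTop,
      27 / 40 < f k ((y k).filter fun η => extend η ∈ boundedNhd T b n) := by
    -- `27 / 40` is the fraction `3 / 4` of the total mass, which exceeds `9 / 10`
    intro n
    refine (hb n).mono fun k hk => ?_
    rw [← apply_eq_sum] at hk
    rw [apply_filter_eq_sum]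
    simp only [Set.indicator_apply] at hk
    linarith [hfy k]
  let ε : ℕ → ℝ := fun n => 1 / 40 * (1 / 2) ^ n
  have hε : ∀ n, 0 < ε n := fun n => by positivity
  let B : ℕ → ℕ := fun r => ∑ l ∈ Finset.range (r + 1), (b l : ℕ)
  obtain ⟨a, haP, har⟩ := exists_seq_of_forall_finset_exists
    (fun a : Block => a.L < a.R ∧ treeNorm T a.z ≤ 1 ∧
      (∀ η, a.z η ≠ 0 → a.L < η.1.length ∧ η.1.length ≤ a.R) ∧
      (∀ η, a.z η ≠ 0 → extend η ∈ boundedNhd T b a.L) ∧ (b 0 : ℕ) ≤ a.L ∧ 1 / 2 ≤ f a.k a.z)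
    (fun a a' : Block => a.n < a'.n ∧ a.k < a'.k ∧ |f a'.k a.z| ≤ ε a.n ∧
      |f a.k a'.z| ≤ ε a'.n ∧ B a.R ≤ a'.L) (by
    intro s _
    -- `n` and the level `L` depend only on the previous blocks; `k` is chosen after them
    let n := s.sup Block.n + 1
    choose Λ hΛ using fun k => exists_level_abs_le T (f k) (hf k) (hε n)
    let L := max (b 0 : ℕ) (s.sup fun a => max (Λ a.k) (B a.R))
    have hL : ∀ a ∈ s, max (Λ a.k) (B a.R) ≤ L := fun a ha =>
      le_max_of_le_right (Finset.le_sup (f := fun a : Block => max (Λ a.k) (B a.R)) ha)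
    have h1 : ∀ᶠ k in atTop, ∀ a ∈ s, a.k < k ∧ |f k a.z| ≤ ε a.n := by
      rw [Filter.eventually_all_finset]
      intro a _
      have h : Tendsto (fun k => |f k a.z|) atTop (𝓝 0) := by simpa using (hnull a.z).abs
      filter_upwards [eventually_gt_atTop a.k, h.eventually_lt_const (hε a.n)] with k hk hk'
      exact ⟨hk, hk'.le⟩
    obtain ⟨k, hk, hks, hkL⟩ := ((hb' L).and_eventually (h1.and
      (eventually_abs_le_of_level_le T hnull L (by norm_num : (0 : ℝ) < 1 / 8)))).exists
    let w := (y k).filter fun η => extend η ∈ boundedNhd T b L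
    have hw : treeNorm T w ≤ 1 := (treeNorm_filter_le T _ _).trans (hy k)
    let z := w.filter fun η => L < η.1.length
    have hz : treeNorm T z ≤ 1 := (treeNorm_filter_le T _ _).trans hw
    have hzL : ∀ η, z η ≠ 0 → L < η.1.length := fun η hη => by
      by_contra h
      exact hη (Finsupp.filter_apply_neg _ _ h)
    have hzw : ∀ η, z η ≠ 0 → w η ≠ 0 := fun η hη h =>
      hη (by rw [Finsupp.filter_apply, h, ite_self])
    obtain ⟨R, hLR, hR⟩ := exists_level_bound z L
    refine ⟨⟨n, k, L, R, z⟩, ⟨hLR, hz, fun η hη => ⟨hzL η hη, hR η hη⟩, fun η hη => ?_,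
      le_max_left _ _, ?_⟩, fun a ha => ⟨?_, (hks a ha).1, (hks a ha).2, ?_, ?_⟩⟩
    · by_contra h
      exact hzw η hη (Finsupp.filter_apply_neg _ _ h)
    · have hlow := hkL (w.filter fun η => ¬ L < η.1.length) ((treeNorm_filter_le T _ _).trans hw)
        fun η hη => by
          by_contra h
          exact hη (Finsupp.filter_apply_neg _ _ (not_not.2 (not_le.1 h)))
      have hsum : f k w = f k z + f k (w.filter fun η => ¬ L < η.1.length) := by
        rw [← map_add, Finsupp.filter_add_filter_not]
      have h2 := le_of_abs_le hlow
      have h3 : 27 / 40 < f k w := hk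
      change 1 / 2 ≤ f k z
      linarith
    · exact Nat.lt_succ_of_le (Finset.le_sup (f := Block.n) ha)
    · exact hΛ a.k z hz fun η hη =>
        ((le_max_left _ _).trans (hL a ha)).trans_lt (hzL η hη)
    · exact (le_max_right _ _).trans (hL a ha))
  have hn : StrictMono fun j => (a j).n := fun i j hij => (har i j hij).1
  have hεn : ∀ j, ε (a j).n ≤ 1 / 40 * (1 / 2) ^ j := fun j =>
    mul_le_mul_of_nonneg_left
      (pow_le_pow_of_le_one (by norm_num) (by norm_num) (hn.le_apply (x := j))) (by norm_num)
  refine ⟨fun j => (a j).k, fun j => (a j).z, fun i j hij => (har i j hij).2.1,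
    fun j => (haP j).2.2.2.2.2, fun j k hjk => ?_, fun c hc n => ?_⟩
  · refine le_trans ?_ (hεn j)
    rcases hjk.lt_or_gt with h | h
    exacts [(har j k h).2.2.1, (har k j h).2.2.2.1]
  · have hne : ∀ j η, (c j • (a j).z) η ≠ 0 → (a j).z η ≠ 0 := fun j η hη h => hη (by simp [h])
    refine treeNorm_sum_le_two (b := b) (fun j => (haP j).1) (fun j => ?_)
      (fun j η hη => (haP j).2.2.1 η (hne j η hη)) (fun j η hη => (haP j).2.2.2.1 η (hne j η hη))
      (fun j => (haP j).2.2.2.2.1) (fun i j hij => (har i j hij).2.2.2.2) n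
    rw [treeNorm_smul]
    exact mul_le_one₀ (hc j) (treeNorm_nonneg T (a j).z) (haP j).2.1

/-! ### From the completion to finitely supported vectors -/

/-- A finitely supported vector as an element of the dense subspace `C00 T` of `E T`. -/
def toC00 (T : Descriptive.tree (Bool × ℕ+)) (v : Node →₀ ℝ) : C00 T := v

/-- The restriction to `c₀₀` of a functional on `E_T`. -/
noncomputable def restrictDual {T : Descriptive.tree (Bool × ℕ+)} (g : StrongDual ℝ (E T)) :
    (Node →₀ ℝ) →ₗ[ℝ] ℝ where
  toFun v := g (toC00 T v : E T)
  map_add' v w := by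
    rw [← map_add, ← UniformSpace.Completion.coe_add]
    rfl
  map_smul' a v := by
    rw [RingHom.id_apply, ← map_smul, ← UniformSpace.Completion.coe_smul]
    rfl

theorem abs_restrictDual_le {T : Descriptive.tree (Bool × ℕ+)} (g : StrongDual ℝ (E T))
    (v : Node →₀ ℝ) : |restrictDual g v| ≤ ‖g‖ * treeNorm T v := by
  have h := g.le_opNorm (toC00 T v : E T)
  rw [UniformSpace.Completion.norm_coe] at h
  exact h

theorem exists_lt_restrictDual {T : Descriptive.tree (Bool × ℕ+)} (g : StrongDual ℝ (E T)) {r : ℝ}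
    (hr0 : 0 ≤ r) (hr : r < ‖g‖) : ∃ v, treeNorm T v ≤ 1 ∧ r < restrictDual g v := by
  by_contra! hcon
  have key : ∀ v : Node →₀ ℝ, |restrictDual g v| ≤ r * treeNorm T v := by
    intro v
    rcases (treeNorm_nonneg T v).eq_or_lt with h0 | h0
    · rw [← h0, eq_zero_of_treeNorm_eq_zero T v h0.symm, map_zero, abs_zero, mul_zero]
    have hs : ∀ s : ℝ, |s| = 1 → s * restrictDual g v ≤ r * treeNorm T v := fun s hs => by
      have h := hcon ((s / treeNorm T v) • v) (by
        rw [treeNorm_smul, abs_div, hs, abs_of_pos h0, one_div_mul_cancel h0.ne'])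
      rwa [map_smul, smul_eq_mul, div_mul_eq_mul_div, div_le_iff₀ h0] at h
    refine abs_le.2 ⟨?_, ?_⟩
    · linarith [hs (-1) (by simp)]
    · linarith [hs 1 (by simp)]
  refine hr.not_ge (g.opNorm_le_bound hr0 fun e => ?_)
  induction e using UniformSpace.Completion.induction_on with
  | hp => exact isClosed_le (by fun_prop) (by fun_prop)
  | ih v =>
    rw [UniformSpace.Completion.norm_coe]
    exact key v

/-- Almost biorthogonality with blocks whose signed sums are bounded yields a lower
`ℓ₁`-estimate. -/
theorem le_norm_sum_of_almost_biorthogonal {T : Descriptive.tree (Bool × ℕ+)}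
    {y : ℕ → StrongDual ℝ (E T)} {z : ℕ → Node →₀ ℝ}
    (hdiag : ∀ j, 1 / 2 ≤ restrictDual (y j) (z j))
    (hoff : ∀ j k, j ≠ k → |restrictDual (y k) (z j)| ≤ 1 / 40 * (1 / 2) ^ j)
    (hsum : ∀ c : ℕ → ℝ, (∀ j, |c j| ≤ 1) →
      ∀ n, treeNorm T (∑ j ∈ Finset.range n, c j • z j) ≤ 2) (n : ℕ) (c : ℕ → ℝ) :
    (1 / 5 : ℝ) * ∑ k ∈ Finset.range n, |c k| ≤ ‖∑ k ∈ Finset.range n, c k • y k‖ := by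
  -- the sum is tested on `v = ∑ j, ε j • z j`, which has norm at most `2`; the off-diagonal terms
  -- cost at most `1 / 20` per functional, so that `(1 / 2 - 1 / 20) / 2 ≥ 1 / 5` remains
  let ε : ℕ → ℝ := fun j => SignType.sign (c j)
  have hε : ∀ j, |ε j| ≤ 1 := fun j => by
    change |((SignType.sign (c j) : SignType) : ℝ)| ≤ 1
    rcases lt_trichotomy (c j) 0 with h | h | h <;> simp [h]
  have hεc : ∀ j, c j * ε j = |c j| := fun j => self_mul_sign (c j)
  let v := ∑ j ∈ Finset.range n, ε j • z j
  have hgeo : ∑ j ∈ Finset.range n, 1 / 40 * (1 / 2 : ℝ) ^ j ≤ 1 / 20 := by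
    rw [← Finset.mul_sum]
    linarith [sum_geometric_two_le n]
  have hterm : ∀ k ∈ Finset.range n, 9 / 20 * |c k| ≤ c k * restrictDual (y k) v := by
    intro k hk
    have h1 : restrictDual (y k) v = ε k * restrictDual (y k) (z k) +
        ∑ j ∈ (Finset.range n).erase k, ε j * restrictDual (y k) (z j) := by
      rw [map_sum, ← Finset.add_sum_erase _ _ hk]
      simp only [map_smul, smul_eq_mul]
    have h2 : |∑ j ∈ (Finset.range n).erase k, ε j * restrictDual (y k) (z j)| ≤ 1 / 20 := by
      refine (Finset.abs_sum_le_sum_abs _ _).trans (le_trans ?_ hgeo)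
      refine (Finset.sum_le_sum fun j hj => ?_).trans
        (Finset.sum_le_sum_of_subset_of_nonneg (Finset.erase_subset k _) fun _ _ _ => by positivity)
      rw [abs_mul]
      exact (mul_le_of_le_one_left (abs_nonneg _) (hε j)).trans
        (hoff j k (Finset.ne_of_mem_erase hj))
    have h3 : |c k * ∑ j ∈ (Finset.range n).erase k, ε j * restrictDual (y k) (z j)| ≤
        |c k| * (1 / 20) := by
      rw [abs_mul]
      exact mul_le_mul_of_nonneg_left h2 (abs_nonneg _)
    have h4 := mul_le_mul_of_nonneg_left (hdiag k) (abs_nonneg (c k))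
    rw [h1, mul_add, ← mul_assoc, hεc]
    linarith [neg_le_of_abs_le h3]
  have hle : 9 / 20 * ∑ k ∈ Finset.range n, |c k| ≤
      restrictDual (∑ k ∈ Finset.range n, c k • y k) v := by
    have : restrictDual (∑ k ∈ Finset.range n, c k • y k) v =
        ∑ k ∈ Finset.range n, c k * restrictDual (y k) v := by
      change (∑ k ∈ Finset.range n, c k • y k) _ = _
      rw [sum_apply]
      rfl
    rw [this, Finset.mul_sum]
    exact Finset.sum_le_sum hterm
  have hnorm := (le_abs_self _).trans (abs_restrictDual_le (∑ k ∈ Finset.range n, c k • y k) v)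
  have h2 := mul_le_mul_of_nonneg_left (hsum ε hε n)
    (norm_nonneg (∑ k ∈ Finset.range n, c k • y k))
  have h0 : 0 ≤ ∑ k ∈ Finset.range n, |c k| := Finset.sum_nonneg fun _ _ => abs_nonneg _
  linarith

end TreeSpace

theorem mainTheorem4 (T : Descriptive.tree (Bool × ℕ+))
    (hT : ∀ σ : ℕ → Bool, TreeSpace.IllFounded (TreeSpace.sect T σ))
    (x : ℕ → StrongDual ℝ (TreeSpace.E T))
    (hnorm : ∀ k, ‖x k‖ = 1)
    (hnull : Tendsto (fun k => StrongDual.toWeakDual (x k)) atTop (𝓝 0)) :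
    ∃ φ : ℕ → ℕ, StrictMono φ ∧
      ∀ (n : ℕ) (c : Fin n → ℝ),
        (1 / 5 : ℝ) * ∑ k, |c k| ≤ ‖∑ k, c k • x (φ k)‖ := by
  have hnull' : ∀ v, Tendsto (fun k => TreeSpace.restrictDual (x k) v) atTop (𝓝 0) := fun v =>
    tendsto_iff_forall_eval_tendsto_topDualPairing.1 hnull (TreeSpace.toC00 T v : TreeSpace.E T)
  obtain ⟨φ, z, hφ, hdiag, hoff, hsum⟩ := TreeSpace.exists_subseq_almost_biorthogonal hT
    (f := fun k => TreeSpace.restrictDual (x k))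
    (fun k v => by simpa [hnorm k] using TreeSpace.abs_restrictDual_le (x k) v)
    (fun k => TreeSpace.exists_lt_restrictDual (x k) (by norm_num) (by rw [hnorm k]; norm_num))
    hnull'
  refine ⟨φ, hφ, fun n c => ?_⟩
  have h := TreeSpace.le_norm_sum_of_almost_biorthogonal (y := fun k => x (φ k)) hdiag hoff hsum n
    fun k => if h : k < n then c ⟨k, h⟩ else 0
  simpa [Finset.sum_range] using h
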